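/- Let $\mathbb{CP}_2$ be the complex projective plane with its complex orientation, and let $g_{FS}$ be its Fubini--Study metric, i.e. the Riemannian metric which in each of the three affine charts, with coordinate $z\in\mathbb C^2$, is given by $$g_{FS}(v,w)=\operatorname{Re}\,\frac{(1+|z|^2)\langle v,w\rangle-\langle v,z\rangle\langle z,w\rangle}{(1+|z|^2)^2}\qquad(v,w\in\mathbb C^2),$$ where $\langle\cdot,\cdot\rangle$ is the standard Hermitian inner product, conjugate-linear in the first argument (equivalently, the quotient metric of the unit sphere $S^5\subset\mathbb C^3$ by the unit complex scalars). Then $(\mathbb{CP}_2,g_{FS})$ is self-dual: if $\Lambda^2=\Lambda^2_+\oplus\Lambda^2_-$ is the decomposition of the $2$-forms into the $\pm1$ eigenspaces of the Hodge star operator, then the component $W_-:\Lambda^2_-\to\Lambda^2_-$ of the Weyl tensor $W$, viewed as an operator $W:\Lambda^2\to\Lambda^2$, vanishes identically. -/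

import Mathlib

open scoped Manifold ContDiff LinearAlgebra.Projectivization

noncomputable section

/-! ## Curvature, Hodge star and self-duality of oriented Riemannian 4-manifolds -/

section Coordinates

/-! Tensor calculus in a coordinate domain of a real normed space `E` with basis `b`.
`G x v w` is the metric at the point `x`, evaluated on `v` and `w`. -/

variable {ι E : Type*} [Fintype ι] [DecidableEq ι] [NormedAddCommGroup E] [NormedSpace ℝ E]

/-- The metric coefficients `g_{ij}`. -/
def metricMatrix (b : Module.Basis ι ℝ E) (G : E → E → E → ℝ) (x : E) : Matrix ι ι ℝ :=
  Matrix.of fun i j => G x (b i) (b j)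

/-- The partial derivative `∂_k g_{ij}`. -/
def metricDeriv (b : Module.Basis ι ℝ E) (G : E → E → E → ℝ) (k i j : ι) (x : E) : ℝ :=
  fderiv ℝ (fun y => metricMatrix b G y i j) x (b k)

/-- The Christoffel symbols `Γ^k_{ij}` of the Levi-Civita connection. -/
def christoffel (b : Module.Basis ι ℝ E) (G : E → E → E → ℝ) (k i j : ι) (x : E) : ℝ :=
  (1 / 2) * ∑ l, (metricMatrix b G x)⁻¹ k l *
    (metricDeriv b G i j l x + metricDeriv b G j i l x - metricDeriv b G l i j x)

/-- The coefficients of `R(∂_i, ∂_j) ∂_k = ∇_i ∇_j ∂_k - ∇_j ∇_i ∂_k = ∑ₗ (curvatureUp l k i j) ∂_l`. -/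
def curvatureUp (b : Module.Basis ι ℝ E) (G : E → E → E → ℝ) (l k i j : ι) (x : E) : ℝ :=
  fderiv ℝ (christoffel b G l j k) x (b i) - fderiv ℝ (christoffel b G l i k) x (b j) +
    ∑ m, (christoffel b G l i m x * christoffel b G m j k x -
      christoffel b G l j m x * christoffel b G m i k x)

/-- The `(0,4)` curvature tensor `R_{ijkl} = g(R(∂_i, ∂_j) ∂_l, ∂_k)`; with this sign convention
`R(X, Y, X, Y)` is the sectional curvature of an orthonormal pair `X, Y`. -/
def riemannTensor (b : Module.Basis ι ℝ E) (G : E → E → E → ℝ) (i j k l : ι) (x : E) : ℝ :=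
  ∑ m, metricMatrix b G x k m * curvatureUp b G m l i j x

/-- The Ricci tensor `Ric_{jl} = g^{ik} R_{ijkl}`. -/
def ricciTensor (b : Module.Basis ι ℝ E) (G : E → E → E → ℝ) (x : E) : Matrix ι ι ℝ :=
  Matrix.of fun j l => ∑ i, ∑ k, (metricMatrix b G x)⁻¹ i k * riemannTensor b G i j k l x

/-- The scalar curvature `s = g^{jl} Ric_{jl}`. -/
def scalarCurvature (b : Module.Basis ι ℝ E) (G : E → E → E → ℝ) (x : E) : ℝ :=
  ∑ j, ∑ l, (metricMatrix b G x)⁻¹ j l * ricciTensor b G x j l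

/-- The trace-free Ricci tensor `Ric - (s / n) g`. -/
def traceFreeRicci (b : Module.Basis ι ℝ E) (G : E → E → E → ℝ) (x : E) : Matrix ι ι ℝ :=
  ricciTensor b G x - (scalarCurvature b G x / Fintype.card ι) • metricMatrix b G x

/-- The Kulkarni–Nomizu product of two symmetric 2-tensors. -/
def kulkarniNomizu (A B : Matrix ι ι ℝ) (i j k l : ι) : ℝ :=
  (A i k * B j l - B i l * A j k) + (B i k * A j l - A i l * B j k)

/-- The Weyl tensor: what is left of the curvature tensor after subtracting
`s / (2n(n-1)) g ∧ g` and `1 / (n-2) Ric₀ ∧ g` (Kulkarni–Nomizu products). -/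
def weylTensor (b : Module.Basis ι ℝ E) (G : E → E → E → ℝ) (i j k l : ι) (x : E) : ℝ :=
  riemannTensor b G i j k l x
    - scalarCurvature b G x / (2 * Fintype.card ι * (Fintype.card ι - 1)) *
        kulkarniNomizu (metricMatrix b G x) (metricMatrix b G x) i j k l
    - 1 / (Fintype.card ι - 2) *
        kulkarniNomizu (traceFreeRicci b G x) (metricMatrix b G x) i j k l

/-! A 2-form at a point is given by its skew-symmetric coefficient matrix `α_{ij} = α(b i, b j)`. -/

/-- Raising both indices: `α^{kl} = g^{ka} g^{lc} α_{ac}`. -/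
def raiseIndices (b : Module.Basis ι ℝ E) (G : E → E → E → ℝ) (x : E) (α : Matrix ι ι ℝ) :
    Matrix ι ι ℝ :=
  Matrix.of fun k l => ∑ a, ∑ c, (metricMatrix b G x)⁻¹ k a * (metricMatrix b G x)⁻¹ l c * α a c

/-- The Weyl tensor as an operator on 2-forms: `(W α)_{ij} = (1/2) W_{ijkl} α^{kl}`. -/
def weylOperator (b : Module.Basis ι ℝ E) (G : E → E → E → ℝ) (x : E) (α : Matrix ι ι ℝ) :
    Matrix ι ι ℝ :=
  Matrix.of fun i j => (1 / 2) * ∑ k, ∑ l, weylTensor b G i j k l x * raiseIndices b G x α k l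

/-- The Levi-Civita symbol on four indices. -/
def leviCivita (i j k l : Fin 4) : ℝ :=
  Matrix.det (Matrix.of fun r c : Fin 4 => if ![i, j, k, l] r = c then (1 : ℝ) else 0)

/-- The Hodge star on 2-forms in dimension four, for the orientation in which `b` is positive:
`(* α)_{ij} = (1/2) √(det g) ε_{ijkl} α^{kl}`. -/
def hodgeStar (b : Module.Basis (Fin 4) ℝ E) (G : E → E → E → ℝ) (x : E)
    (α : Matrix (Fin 4) (Fin 4) ℝ) : Matrix (Fin 4) (Fin 4) ℝ :=
  Matrix.of fun i j => (1 / 2) * ∑ k, ∑ l,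
    √(metricMatrix b G x).det * leviCivita i j k l * raiseIndices b G x α k l

/-- The projection of 2-forms onto the `-1` eigenspace `Λ²₋` of the Hodge star. -/
def antiSelfDualPart (b : Module.Basis (Fin 4) ℝ E) (G : E → E → E → ℝ) (x : E)
    (α : Matrix (Fin 4) (Fin 4) ℝ) : Matrix (Fin 4) (Fin 4) ℝ :=
  (1 / 2 : ℝ) • (α - hodgeStar b G x α)

/-- The component `W₋ : Λ²₋ → Λ²₋` of the Weyl operator, extended by zero to `Λ²₊`. -/
def weylMinus (b : Module.Basis (Fin 4) ℝ E) (G : E → E → E → ℝ) (x : E)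
    (α : Matrix (Fin 4) (Fin 4) ℝ) : Matrix (Fin 4) (Fin 4) ℝ :=
  antiSelfDualPart b G x (weylOperator b G x (antiSelfDualPart b G x α))

end Coordinates

section Manifolds

open Bundle

/-- The charts of the given atlas of `M` are pairwise compatible as oriented charts: all coordinate
changes have positive Jacobian determinant. Together with an orientation of the model space `E`,
such an atlas orients `M`. -/
class HasOrientedAtlas (E M : Type*) [NormedAddCommGroup E] [NormedSpace ℝ E]
    [TopologicalSpace M] [ChartedSpace E M] : Prop where
  det_pos : ∀ e ∈ atlas E M, ∀ e' ∈ atlas E M, ∀ x ∈ (e.symm.trans e').source,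
    0 < (fderiv ℝ (e.symm.trans e') x).det

variable {E M : Type*} [NormedAddCommGroup E] [NormedSpace ℝ E] [TopologicalSpace M]
  [ChartedSpace E M] [IsManifold 𝓘(ℝ, E) ∞ M]

/-- A Riemannian metric on `M` read in a chart `e`: the pullback of `g` under `e.symm`. -/
def metricInChart
    (g : ContMDiffRiemannianMetric 𝓘(ℝ, E) ∞ E (fun p : M => TangentSpace 𝓘(ℝ, E) p))
    (e : OpenPartialHomeomorph M E) (x v w : E) : ℝ :=
  g.inner (e.symm x) (mfderiv 𝓘(ℝ, E) 𝓘(ℝ, E) e.symm x v) (mfderiv 𝓘(ℝ, E) 𝓘(ℝ, E) e.symm x w)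

/-- A Riemannian metric `g` on the oriented 4-manifold `M` is self-dual if `W₋ ≡ 0`. The orientation
is the one for which the charts of the atlas are positive when `E` is oriented by the basis `b`. -/
def IsSelfDual [HasOrientedAtlas E M] (b : Module.Basis (Fin 4) ℝ E)
    (g : ContMDiffRiemannianMetric 𝓘(ℝ, E) ∞ E (fun p : M => TangentSpace 𝓘(ℝ, E) p)) : Prop :=
  ∀ e ∈ atlas E M, ∀ x ∈ e.target, ∀ α : Matrix (Fin 4) (Fin 4) ℝ, α.transpose = -α →
    weylMinus b (metricInChart g e) x α = 0

end Manifolds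

/-! ## Complex projective space and the Fubini–Study metric -/

/-- `ℂⁿ` with its Hermitian inner product. -/
abbrev CAff (n : ℕ) : Type := EuclideanSpace ℂ (Fin n)

/-- Complex projective space `ℂPⁿ`. -/
abbrev CP (n : ℕ) : Type := ℙ ℂ (CAff (n + 1))

namespace CP
variable {n : ℕ}

/-- The quotient topology. -/
instance : TopologicalSpace (CP n) :=
  inferInstanceAs (TopologicalSpace (Quotient (projectivizationSetoid ℂ (CAff (n + 1)))))

/-- `z ↦ (z₁, …, 1, …, zₙ)`, with the `1` in position `i`. -/
def affineLift (i : Fin (n + 1)) (z : CAff n) : CAff (n + 1) :=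
  WithLp.toLp 2 (i.insertNth (α := fun _ => ℂ) 1 z)

@[simp] theorem affineLift_same (i : Fin (n + 1)) (z : CAff n) : affineLift i z i = 1 := by
  simp [affineLift]

@[simp] theorem affineLift_succAbove (i : Fin (n + 1)) (z : CAff n) (k : Fin n) :
    affineLift i z (i.succAbove k) = z k := by
  simp [affineLift]

theorem affineLift_ne_zero (i : Fin (n + 1)) (z : CAff n) : affineLift i z ≠ 0 := by
  intro h
  have := affineLift_same i z
  simp [h] at this

/-- `w ↦ (wₖ / wᵢ)_{k ≠ i}`. -/
def affineCoord (i : Fin (n + 1)) (w : CAff (n + 1)) : CAff n :=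
  WithLp.toLp 2 fun k => w (i.succAbove k) / w i

theorem affineCoord_smul (i : Fin (n + 1)) {t : ℂ} (ht : t ≠ 0) (w : CAff (n + 1)) :
    affineCoord i (t • w) = affineCoord i w := by
  ext k
  simp [affineCoord, mul_div_mul_left _ _ ht]

theorem affineCoord_lift (i : Fin (n + 1)) (z : CAff n) : affineCoord i (affineLift i z) = z := by
  ext k
  simp [affineCoord]

theorem affineLift_coord (i : Fin (n + 1)) {w : CAff (n + 1)} (hw : w i ≠ 0) :
    affineLift i (affineCoord i w) = (w i)⁻¹ • w := by
  ext j
  refine Fin.succAboveCases i ?_ (fun k => ?_) j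
  · simp [hw]
  · simp [affineCoord, div_eq_inv_mul]

theorem smul_ne_zero_of_eq {a b : {v : CAff (n + 1) // v ≠ 0}} {t : ℂ}
    (h : (a : CAff (n + 1)) = t • (b : CAff (n + 1))) : t ≠ 0 := by
  rintro rfl
  exact a.2 (by simpa using h)

theorem continuous_affineLift (i : Fin (n + 1)) : Continuous (affineLift i : CAff n → _) := by
  refine (PiLp.continuous_toLp 2 _).comp ?_
  refine continuous_pi fun j => ?_
  refine Fin.succAboveCases i ?_ (fun k => ?_) j
  · simpa using continuous_const
  · simp; fun_prop

theorem isQuotientMap_mk' :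
    Topology.IsQuotientMap (Projectivization.mk' ℂ : {v : CAff (n + 1) // v ≠ 0} → CP n) :=
  isQuotientMap_quotient_mk'

theorem isOpen_affineSource (i : Fin (n + 1)) : IsOpen {p : CP n | p.rep i ≠ 0} := by
  rw [← isQuotientMap_mk'.isOpen_preimage]
  have : (Projectivization.mk' ℂ : {v : CAff (n + 1) // v ≠ 0} → CP n) ⁻¹' {p | p.rep i ≠ 0} =
      {v : {v : CAff (n + 1) // v ≠ 0} | v.1 i ≠ 0} := by
    ext v
    obtain ⟨a, ha⟩ := Projectivization.exists_smul_eq_mk_rep ℂ v.1 v.2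
    simp [← ha, Units.smul_def]
  rw [this]
  exact isOpen_ne_fun (by fun_prop) continuous_const

/-- The standard affine chart `[w₀ : ⋯ : wₙ] ↦ (wₖ / wᵢ)_{k ≠ i}` on `{wᵢ ≠ 0}`. -/
def affineChart (i : Fin (n + 1)) : OpenPartialHomeomorph (CP n) (CAff n) where
  toFun p := affineCoord i p.rep
  invFun z := Projectivization.mk ℂ (affineLift i z) (affineLift_ne_zero i z)
  source := {p | p.rep i ≠ 0}
  target := Set.univ
  map_source' _ _ := Set.mem_univ _
  map_target' z _ := by
    obtain ⟨a, ha⟩ := Projectivization.exists_smul_eq_mk_rep ℂ _ (affineLift_ne_zero i z)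
    simp [← ha, Units.smul_def]
  left_inv' p hp := by
    conv_rhs => rw [← Projectivization.mk_rep p]
    rw [Projectivization.mk_eq_mk_iff']
    exact ⟨(p.rep i)⁻¹, (affineLift_coord i hp).symm⟩
  right_inv' z _ := by
    obtain ⟨a, ha⟩ := Projectivization.exists_smul_eq_mk_rep ℂ _ (affineLift_ne_zero i z)
    rw [← ha, Units.smul_def, affineCoord_smul i a.ne_zero, affineCoord_lift]
  open_source := isOpen_affineSource i
  open_target := isOpen_univ
  continuousOn_toFun := by
    have hs := isOpen_affineSource (n := n) i
    rw [isQuotientMap_mk'.continuousOn_isOpen_iff hs]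
    have : ∀ v : {v : CAff (n + 1) // v ≠ 0},
        affineCoord i (Projectivization.mk' ℂ v : CP n).rep = affineCoord i v.1 := by
      intro v
      obtain ⟨a, ha⟩ := Projectivization.exists_smul_eq_mk_rep ℂ v.1 v.2
      rw [Projectivization.mk'_eq_mk, ← ha, Units.smul_def, affineCoord_smul i a.ne_zero]
    have h2 : ∀ v ∈ (Projectivization.mk' ℂ : {v : CAff (n + 1) // v ≠ 0} → CP n) ⁻¹'
        {p | p.rep i ≠ 0}, (v : CAff (n + 1)) i ≠ 0 := by
      intro v
      obtain ⟨a, ha⟩ := Projectivization.exists_smul_eq_mk_rep ℂ v.1 v.2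
      simp [← ha, Units.smul_def]
    refine ContinuousOn.congr ?_ (fun v _ => this v)
    refine (PiLp.continuous_toLp 2 _).comp_continuousOn ?_
    refine continuousOn_pi.2 fun k => ?_
    exact ContinuousOn.div (by fun_prop) (by fun_prop) h2
  continuousOn_invFun :=
    (isQuotientMap_mk'.continuous.comp
      ((continuous_affineLift i).subtype_mk (affineLift_ne_zero i))).continuousOn

theorem exists_rep_ne_zero (p : CP n) : ∃ i, p.rep i ≠ 0 := by
  by_contra! h
  exact p.rep_nonzero (by ext i; simpa using h i)

/-- The atlas of the `n + 1` affine charts. -/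
instance : ChartedSpace (CAff n) (CP n) where
  atlas := Set.range affineChart
  chartAt p := affineChart (exists_rep_ne_zero p).choose
  mem_chart_source p := (exists_rep_ne_zero p).choose_spec
  chart_mem_atlas _ := Set.mem_range_self _

/-- The coordinate change from the `i`-th to the `j`-th affine chart. -/
def coordChange (i j : Fin (n + 1)) (z : CAff n) : CAff n := affineCoord j (affineLift i z)

theorem affineChart_symm_trans (i j : Fin (n + 1)) (z : CAff n) :
    affineChart j ((affineChart i).symm z) = coordChange i j z := by
  obtain ⟨a, ha⟩ := Projectivization.exists_smul_eq_mk_rep ℂ _ (affineLift_ne_zero i z)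
  change affineCoord j (Projectivization.mk ℂ (affineLift i z) _).rep = _
  rw [← ha, Units.smul_def, affineCoord_smul j a.ne_zero, coordChange]

theorem affineChart_symm_trans_source (i j : Fin (n + 1)) :
    ((affineChart i).symm.trans (affineChart j)).source = {z : CAff n | affineLift i z j ≠ 0} := by
  ext z
  obtain ⟨a, ha⟩ := Projectivization.exists_smul_eq_mk_rep ℂ _ (affineLift_ne_zero i z)
  simp only [OpenPartialHomeomorph.trans_source, OpenPartialHomeomorph.symm_source]
  change z ∈ Set.univ ∧ (Projectivization.mk ℂ (affineLift i z) _).rep j ≠ 0 ↔ _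
  rw [← ha, Units.smul_def]
  simp

theorem contDiff_affineLift (i j : Fin (n + 1)) :
    ContDiff ℂ ω fun z : CAff n => affineLift i z j := by
  refine Fin.succAboveCases i ?_ (fun k => ?_) j
  · simpa using contDiff_const
  · simp only [affineLift_succAbove]
    fun_prop

theorem contDiffOn_coordChange (i j : Fin (n + 1)) :
    ContDiffOn ℂ ω (coordChange i j) {z : CAff n | affineLift i z j ≠ 0} := by
  rw [contDiffOn_piLp]
  intro k
  exact (contDiff_affineLift i _).contDiffOn.div (contDiff_affineLift i j).contDiffOn
    fun z hz => hz

/-- `ℂPⁿ` is a complex manifold. -/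
instance : IsManifold 𝓘(ℂ, CAff n) ω (CP n) := by
  refine isManifold_of_contDiffOn _ _ _ ?_
  rintro _ _ ⟨i, rfl⟩ ⟨j, rfl⟩
  simp only [modelWithCornersSelf_coe, modelWithCornersSelf_coe_symm, Function.id_comp,
    Function.comp_id, Set.preimage_id, Set.range_id, Set.inter_univ,
    affineChart_symm_trans_source]
  exact (contDiffOn_coordChange i j).congr fun z _ => affineChart_symm_trans i j z

/-- `ℂPⁿ` is a smooth (real) manifold. -/
instance : IsManifold 𝓘(ℝ, CAff n) ∞ (CP n) := by
  refine isManifold_of_contDiffOn _ _ _ ?_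
  rintro _ _ ⟨i, rfl⟩ ⟨j, rfl⟩
  simp only [modelWithCornersSelf_coe, modelWithCornersSelf_coe_symm, Function.id_comp,
    Function.comp_id, Set.preimage_id, Set.range_id, Set.inter_univ,
    affineChart_symm_trans_source]
  exact ((((contDiffOn_coordChange i j).restrict_scalars ℝ).of_le le_top)).congr
    fun z _ => affineChart_symm_trans i j z

theorem coordChange_leftInv {i j : Fin (n + 1)} {z : CAff n} (hz : affineLift i z j ≠ 0) :
    coordChange j i (coordChange i j z) = z := by
  rw [coordChange, coordChange, affineLift_coord j hz, affineCoord_smul i (inv_ne_zero hz),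
    affineCoord_lift]

theorem isOpen_coordChange_source (i j : Fin (n + 1)) :
    IsOpen {z : CAff n | affineLift i z j ≠ 0} :=
  isOpen_ne_fun (contDiff_affineLift i j).continuous continuous_const

theorem differentiableAt_coordChange {i j : Fin (n + 1)} {z : CAff n} (hz : affineLift i z j ≠ 0) :
    DifferentiableAt ℂ (coordChange i j) z :=
  ((contDiffOn_coordChange i j).contDiffAt ((isOpen_coordChange_source i j).mem_nhds hz)
    ).differentiableAt (by simp)

theorem coordChange_mem {i j : Fin (n + 1)} {z : CAff n} (hz : affineLift i z j ≠ 0) :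
    affineLift j (coordChange i j z) i ≠ 0 := by
  rw [coordChange, affineLift_coord j hz]
  simpa using hz

theorem det_fderiv_coordChange_pos {i j : Fin (n + 1)} {z : CAff n} (hz : affineLift i z j ≠ 0) :
    0 < (fderiv ℝ (coordChange i j) z).det := by
  have h1 := differentiableAt_coordChange hz
  have h2 := differentiableAt_coordChange (coordChange_mem hz)
  have hcomp : (fderiv ℂ (coordChange j i) (coordChange i j z)).comp
      (fderiv ℂ (coordChange i j) z) = ContinuousLinearMap.id ℂ _ := by
    rw [← fderiv_comp z h2 h1, ← fderiv_id (x := z)]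
    refine Filter.EventuallyEq.fderiv_eq ?_
    filter_upwards [(isOpen_coordChange_source i j).mem_nhds hz] with y hy
    exact coordChange_leftInv hy
  have hdet : LinearMap.det (fderiv ℂ (coordChange i j) z : CAff n →ₗ[ℂ] CAff n) ≠ 0 := by
    intro h0
    have := congrArg (fun A : CAff n →L[ℂ] CAff n => LinearMap.det (A : CAff n →ₗ[ℂ] CAff n)) hcomp
    simp only [ContinuousLinearMap.toLinearMap_comp, LinearMap.det_comp, h0, mul_zero] at this
    simp at this
  rw [h1.fderiv_restrictScalars ℝ, ContinuousLinearMap.det]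
  have := LinearMap.det_restrictScalars (R := ℝ)
    (f := (fderiv ℂ (coordChange i j) z : CAff n →ₗ[ℂ] CAff n))
  rw [Algebra.norm_complex_apply] at this
  refine lt_of_lt_of_eq (Complex.normSq_pos.2 hdet) ?_
  exact this.symm

/-- The affine atlas is oriented, since coordinate changes are holomorphic. -/
instance : HasOrientedAtlas (CAff n) (CP n) where
  det_pos := by
    rintro _ ⟨i, rfl⟩ _ ⟨j, rfl⟩ z hz
    rw [affineChart_symm_trans_source] at hz
    have e : ((affineChart i).symm.trans (affineChart j) : CAff n → CAff n) = coordChange i j :=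
      funext fun z => affineChart_symm_trans i j z
    rw [e]
    exact det_fderiv_coordChange_pos hz

/-- The Fubini–Study metric in affine coordinates `z ∈ ℂⁿ`: the real part of the Hermitian form
`((1 + |z|²) ⟨v, w⟩ - ⟨v, z⟩ ⟨z, w⟩) / (1 + |z|²)²`, for tangent vectors `v, w ∈ ℂⁿ`. -/
def fubiniStudyForm (z v w : CAff n) : ℝ :=
  (((1 + (‖z‖ : ℂ) ^ 2) * inner ℂ v w - inner ℂ v z * inner ℂ z w) / (1 + (‖z‖ : ℂ) ^ 2) ^ 2).re

/-- The Fubini–Study form in homogeneous coordinates `u`: the inner product of the components of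
`X` and `Y` orthogonal to `u`, divided by `|u|²`. -/
def homogeneousForm (u X Y : CAff (n + 1)) : ℝ :=
  ((inner ℂ u u * inner ℂ X Y - inner ℂ X u * inner ℂ u Y) / (inner ℂ u u) ^ 2).re

theorem homogeneousForm_smul {u : CAff (n + 1)} (hu : u ≠ 0) {t : ℂ} (ht : t ≠ 0) (a b : ℂ)
    (X Y : CAff (n + 1)) :
    homogeneousForm (t • u) (t • X + a • u) (t • Y + b • u) = homogeneousForm u X Y := by
  have hu' : inner ℂ u u ≠ 0 := inner_self_ne_zero.2 hu
  have ht' : (starRingEnd ℂ) t ≠ 0 := by simpa using ht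
  unfold homogeneousForm
  congr 1
  simp only [inner_add_left, inner_add_right, inner_smul_left, inner_smul_right]
  field_simp
  ring

/-- The derivative of `affineLift i`. -/
def affineDir (i : Fin (n + 1)) (v : CAff n) : CAff (n + 1) :=
  WithLp.toLp 2 (i.insertNth (α := fun _ => ℂ) 0 v)

@[simp] theorem affineDir_same (i : Fin (n + 1)) (z : CAff n) : affineDir i z i = 0 := by
  simp [affineDir]

@[simp] theorem affineDir_succAbove (i : Fin (n + 1)) (z : CAff n) (k : Fin n) :
    affineDir i z (i.succAbove k) = z k := by
  simp [affineDir]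

theorem homogeneousForm_affine (i : Fin (n + 1)) (z v w : CAff n) :
    homogeneousForm (affineLift i z) (affineDir i v) (affineDir i w) = fubiniStudyForm z v w := by
  have h1 : inner ℂ (affineLift i z) (affineLift i z) = 1 + (‖z‖ : ℂ) ^ 2 := by
    have : (‖z‖ : ℂ) ^ 2 = inner ℂ z z := (inner_self_eq_norm_sq_to_K (𝕜 := ℂ) z).symm
    rw [this, PiLp.inner_apply, PiLp.inner_apply, Fin.sum_univ_succAbove _ i]
    simp
  have h2 : inner ℂ (affineDir i v) (affineDir i w) = inner ℂ v w := by
    simp [PiLp.inner_apply, Fin.sum_univ_succAbove _ i]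
  have h3 : inner ℂ (affineDir i v) (affineLift i z) = inner ℂ v z := by
    simp [PiLp.inner_apply, Fin.sum_univ_succAbove _ i]
  have h4 : inner ℂ (affineLift i z) (affineDir i w) = inner ℂ z w := by
    simp [PiLp.inner_apply, Fin.sum_univ_succAbove _ i]
  rw [homogeneousForm, fubiniStudyForm, h1, h2, h3, h4]

theorem differentiableAt_affineLift_coord (i j : Fin (n + 1)) (z : CAff n) :
    DifferentiableAt ℂ (fun z => affineLift i z j) z ∧
    ∀ v, fderiv ℂ (fun z => affineLift i z j) z v = affineDir i v j := by
  refine ⟨(contDiff_affineLift i j).contDiffAt.differentiableAt (by simp), fun v => ?_⟩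
  refine Fin.succAboveCases i ?_ (fun k => ?_) j
  · simp
  · simp only [affineLift_succAbove, affineDir_succAbove]
    exact congrArg (fun A : CAff n →L[ℂ] ℂ => A v)
      (EuclideanSpace.proj k : CAff n →L[ℂ] ℂ).fderiv

theorem affineDir_fderiv_coordChange {i j : Fin (n + 1)} {z : CAff n} (hz : affineLift i z j ≠ 0)
    (v : CAff n) :
    affineDir j (fderiv ℝ (coordChange i j) z v) =
      (affineLift i z j)⁻¹ • affineDir i v +
        (-(affineDir i v j) / (affineLift i z j) ^ 2) • affineLift i z := by
  have h1 := differentiableAt_coordChange hz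
  rw [h1.fderiv_restrictScalars ℝ]
  have key : ∀ k, (fderiv ℂ (coordChange i j) z v) k =
      (affineDir i v (j.succAbove k) * affineLift i z j -
        affineLift i z (j.succAbove k) * affineDir i v j) / (affineLift i z j) ^ 2 := by
    intro k
    have h2 : (fderiv ℂ (coordChange i j) z v) k =
        fderiv ℂ (fun y => coordChange i j y k) z v := by
      have := ((EuclideanSpace.proj k : CAff n →L[ℂ] ℂ).hasFDerivAt.comp z h1.hasFDerivAt).fderiv
      change fderiv ℂ (fun y => coordChange i j y k) z = _ at this
      rw [this]
      rfl
    obtain ⟨da, ha⟩ := differentiableAt_affineLift_coord i (j.succAbove k) z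
    obtain ⟨db, hb⟩ := differentiableAt_affineLift_coord i j z
    rw [h2]
    change fderiv ℂ (fun y => affineLift i y (j.succAbove k) / affineLift i y j) z v = _
    have hd := da.hasFDerivAt.mul ((hasDerivAt_inv hz).comp_hasFDerivAt z db.hasFDerivAt)
    have hd' := congrArg (fun A : CAff n →L[ℂ] ℂ => A v) hd.fderiv
    simp only [div_eq_mul_inv]
    refine hd'.trans ?_
    simp [ha, hb]
    field_simp
    ring
  ext l
  refine Fin.succAboveCases j ?_ (fun k => ?_) l
  · simp
    field_simp
    ring
  · simp [key]
    field_simp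
    ring

theorem fubiniStudyForm_coordChange {i j : Fin (n + 1)} {z : CAff n} (hz : affineLift i z j ≠ 0)
    (v w : CAff n) :
    fubiniStudyForm (coordChange i j z) (fderiv ℝ (coordChange i j) z v)
      (fderiv ℝ (coordChange i j) z w) = fubiniStudyForm z v w := by
  rw [← homogeneousForm_affine j, ← homogeneousForm_affine i, affineDir_fderiv_coordChange hz,
    affineDir_fderiv_coordChange hz, coordChange, affineLift_coord j hz,
    homogeneousForm_smul (affineLift_ne_zero i z) (inv_ne_zero hz)]

theorem one_add_norm_sq (z : CAff n) : (1 + (‖z‖ : ℂ) ^ 2) = ((1 + ‖z‖ ^ 2 : ℝ) : ℂ) := by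
  push_cast; rfl

theorem fubiniStudyForm_eq (z v w : CAff n) : fubiniStudyForm z v w =
    ((1 + ‖z‖ ^ 2) * (inner ℂ v w).re - (inner ℂ v z * inner ℂ z w).re) / (1 + ‖z‖ ^ 2) ^ 2 := by
  rw [fubiniStudyForm, one_add_norm_sq, ← Complex.ofReal_pow, Complex.div_ofReal_re,
    Complex.sub_re, Complex.re_ofReal_mul]

/-- The Fubini–Study form at `z` as a real bilinear form. -/
def fubiniStudyBilin (z : CAff n) : CAff n →ₗ[ℝ] CAff n →ₗ[ℝ] ℝ :=
  LinearMap.mk₂ ℝ (fubiniStudyForm z)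
    (fun v v' w => by
      simp only [fubiniStudyForm_eq, inner_add_left, add_mul, Complex.add_re]; ring)
    (fun c v w => by
      have h : (c • v : CAff n) = (c : ℂ) • v := by ext; simp
      simp only [fubiniStudyForm_eq, h, inner_smul_left, Complex.conj_ofReal, mul_assoc,
        Complex.re_ofReal_mul, smul_eq_mul]
      ring)
    (fun v w w' => by
      simp only [fubiniStudyForm_eq, inner_add_right, mul_add, Complex.add_re]; ring)
    (fun c v w => by
      have h : (c • w : CAff n) = (c : ℂ) • w := by ext; simp
      simp only [fubiniStudyForm_eq, h, inner_smul_right, mul_left_comm _ (c : ℂ),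
        Complex.re_ofReal_mul, smul_eq_mul]
      ring)

theorem fubiniStudyForm_symm (z v w : CAff n) :
    fubiniStudyForm z v w = fubiniStudyForm z w v := by
  rw [fubiniStudyForm_eq, fubiniStudyForm_eq, ← inner_conj_symm v w, ← inner_conj_symm v z,
    ← inner_conj_symm z w, ← map_mul, Complex.conj_re, Complex.conj_re, mul_comm (inner ℂ z v)]

theorem le_fubiniStudyForm (z v : CAff n) :
    ‖v‖ ^ 2 / (1 + ‖z‖ ^ 2) ^ 2 ≤ fubiniStudyForm z v v := by
  rw [fubiniStudyForm_eq]
  have h1 : (inner ℂ v v).re = ‖v‖ ^ 2 := by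
    rw [inner_self_eq_norm_sq_to_K (𝕜 := ℂ)]; norm_cast
  have h2 : (inner ℂ v z * inner ℂ z v).re ≤ ‖v‖ ^ 2 * ‖z‖ ^ 2 := by
    refine (Complex.re_le_norm _).trans ?_
    rw [norm_mul]
    have a := norm_inner_le_norm (𝕜 := ℂ) v z
    have b := norm_inner_le_norm (𝕜 := ℂ) z v
    calc _ ≤ (‖v‖ * ‖z‖) * (‖z‖ * ‖v‖) := by gcongr
      _ = _ := by ring
  gcongr
  rw [h1]
  nlinarith

/-- The Fubini–Study form at `z` as a continuous bilinear form. -/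
def fubiniStudyCLM (z : CAff n) : CAff n →L[ℝ] CAff n →L[ℝ] ℝ :=
  (fubiniStudyBilin z).toContinuousBilinearMap

theorem fubiniStudyCLM_apply (z v w : CAff n) : fubiniStudyCLM z v w = fubiniStudyForm z v w := rfl

theorem contDiff_fubiniStudyCLM : ContDiff ℝ ∞ (fubiniStudyCLM : CAff n → _) := by
  rw [contDiff_clm_apply_iff]
  intro v
  rw [contDiff_clm_apply_iff]
  intro w
  simp only [fubiniStudyCLM_apply, fubiniStudyForm_eq]
  have hn : ContDiff ℝ ∞ fun z : CAff n => ‖z‖ ^ 2 := by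
    simp only [EuclideanSpace.norm_sq_eq, ← Complex.normSq_eq_norm_sq, Complex.normSq_apply]
    have : ∀ k, ContDiff ℝ ∞ fun z : CAff n => z k := fun k => by fun_prop
    have h1 : ∀ k, ContDiff ℝ ∞ fun z : CAff n => (z k).re := fun k => Complex.reCLM.contDiff.comp (this k)
    have h2 : ∀ k, ContDiff ℝ ∞ fun z : CAff n => (z k).im := fun k => Complex.imCLM.contDiff.comp (this k)
    fun_prop
  have hi : ContDiff ℝ ∞ fun z : CAff n => inner ℂ v z :=
    ((innerSL ℂ v).restrictScalars ℝ).contDiff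
  have hj : ContDiff ℝ ∞ fun z : CAff n => inner ℂ z w := by
    have : (fun z : CAff n => inner ℂ z w) = fun z => Complex.conjCLE (inner ℂ w z) := by
      ext z; simp
    rw [this]
    exact Complex.conjCLE.contDiff.comp ((innerSL ℂ w).restrictScalars ℝ).contDiff
  have hr : ContDiff ℝ ∞ fun z : CAff n => (inner ℂ v z * inner ℂ z w).re :=
    Complex.reCLM.contDiff.comp (hi.mul hj)
  refine ContDiff.div ?_ ?_ fun z => by positivity
  · fun_prop
  · fun_prop

theorem fubiniStudy_inCoordinates (p q : CP n) (hq : q ∈ (chartAt (CAff n) p).source) (v w : CAff n) :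
    fubiniStudyForm (chartAt (CAff n) q q)
      ((tangentCoordChange 𝓘(ℝ, CAff n) p q q) v) ((tangentCoordChange 𝓘(ℝ, CAff n) p q q) w)
      = fubiniStudyForm (chartAt (CAff n) p q) v w := by
  obtain ⟨i, hi⟩ : ∃ i, chartAt (CAff n) p = affineChart i := ⟨_, rfl⟩
  obtain ⟨j, hj⟩ : ∃ j, chartAt (CAff n) q = affineChart j := ⟨_, rfl⟩
  have hq' := mem_chart_source (CAff n) q
  rw [hi] at hq
  rw [hj] at hq'
  have e : (affineChart j) ∘ (affineChart i).symm = coordChange (n := n) i j :=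
    funext fun z => affineChart_symm_trans i j z
  rw [tangentCoordChange_def]
  simp only [mfld_simps, fderivWithin_univ]
  rw [hi, hj, e]
  have hs : affineLift i (affineChart i q) j ≠ 0 := by
    have : affineChart i q ∈ ((affineChart i).symm.trans (affineChart j)).source := by
      simp [hq, hq']
    rwa [affineChart_symm_trans_source] at this
  have : affineChart j q = coordChange i j (affineChart i q) := by
    rw [← affineChart_symm_trans, (affineChart i).left_inv hq]
  rw [this, fubiniStudyForm_coordChange hs]

/-- The Fubini–Study metric at `p`; the tangent space at `p` is the coordinate space `ℂⁿ` of the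
preferred affine chart at `p`. -/
def fubiniStudyAt (p : CP n) :
    TangentSpace 𝓘(ℝ, CAff n) p →L[ℝ] TangentSpace 𝓘(ℝ, CAff n) p →L[ℝ] ℝ :=
  fubiniStudyCLM (chartAt (CAff n) p p)

open Bundle in
/-- The Fubini–Study metric on `ℂPⁿ`. -/
def fubiniStudy : ContMDiffRiemannianMetric 𝓘(ℝ, CAff n) ∞ (CAff n)
    (fun p : CP n => TangentSpace 𝓘(ℝ, CAff n) p) where
  inner p := fubiniStudyAt p
  symm p v w := fubiniStudyForm_symm _ _ _
  pos p v hv := by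
    refine lt_of_lt_of_le ?_ (le_fubiniStudyForm _ _)
    have : 0 < ‖(show CAff n from v)‖ := norm_pos_iff.2 hv
    positivity
  isVonNBounded p := by
    set z := chartAt (CAff n) p p
    refine (NormedSpace.isVonNBounded_ball ℝ (CAff n) (1 + ‖z‖ ^ 2)).subset ?_
    intro v hv
    have h1 := (le_fubiniStudyForm z v).trans_lt hv
    rw [div_lt_one (by positivity)] at h1
    have := lt_of_pow_lt_pow_left₀ 2 (by positivity) h1
    simpa using this
  contMDiff := by
    intro p
    rw [contMDiffAt_section]
    have h : ContMDiffAt 𝓘(ℝ, CAff n) 𝓘(ℝ, CAff n →L[ℝ] CAff n →L[ℝ] ℝ) ∞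
        (fun q : CP n => fubiniStudyCLM (chartAt (CAff n) p q)) p := by
      refine (contDiff_fubiniStudyCLM.contMDiff.contMDiffAt).comp p ?_
      exact contMDiffAt_extChartAt
    refine h.congr_of_eventuallyEq ?_
    filter_upwards [(chartAt (CAff n) p).open_source.mem_nhds (mem_chart_source (CAff n) p)]
      with q hq
    rw [hom_trivializationAt_apply]
    ext v w
    rw [inCoordinates_apply_eq₂ hq hq (Set.mem_univ _)]
    have h2 := fubiniStudy_inCoordinates p q hq v w
    have h3 := TangentBundle.symmL_trivializationAt_eq_core (I := 𝓘(ℝ, CAff n)) hq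
    change (trivializationAt (CAff n) (TangentSpace 𝓘(ℝ, CAff n)) p).symmL ℝ q =
      tangentCoordChange 𝓘(ℝ, CAff n) p q q at h3
    have h4 (u : CAff n) : tangentCoordChange 𝓘(ℝ, CAff n) p q q u =
        (trivializationAt (CAff n) (TangentSpace 𝓘(ℝ, CAff n)) p).symm q u := by
      rw [← h3]
      exact Trivialization.symmL_apply (hb := hq) ..
    rw [h4, h4] at h2
    refine Eq.trans ?_ h2
    simp only [Trivial.fiberBundle_trivializationAt', Trivial.linearMapAt_trivialization]
    rfl

/-- The real linear isomorphism `ℂ² ≃ ℝ⁴`, `(x₁ + i y₁, x₂ + i y₂) ↦ (x₁, y₁, x₂, y₂)`. -/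
def realCoord : CAff 2 ≃ₗ[ℝ] (Fin 4 → ℝ) where
  toFun z := ![(z 0).re, (z 0).im, (z 1).re, (z 1).im]
  invFun c := !₂[⟨c 0, c 1⟩, ⟨c 2, c 3⟩]
  map_add' z w := by
    ext k; fin_cases k <;> simp
  map_smul' c z := by
    ext k; fin_cases k <;> simp
  left_inv z := by
    ext k; fin_cases k <;> simp
  right_inv c := by
    ext k; fin_cases k <;> simp

/-- The real basis `(1,0), (i,0), (0,1), (0,i)` of `ℂ²`; it defines the complex orientation. -/
def realBasis : Module.Basis (Fin 4) ℝ (CAff 2) := Module.Basis.ofEquivFun realCoord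

end CP

end

open scoped Manifold ContDiff LinearAlgebra.Projectivization

noncomputable section

/-! ### The metric read in an affine chart. -/

namespace CP
variable {n : ℕ}

/-! In every affine chart the metric is `g = Re h`, where `h` is a Hermitian form built from `N = 1
+ |z|²` and the (1,0)-form `θ = ∂ log N`. The first derivatives of `θ` and `h` are again polynomials
in `θ`, `h` and their conjugates. The Levi-Civita connection is therefore explicit, `∇_v w = -(θ(v)
w + θ(w) v)` on constant fields (`fubiniStudyForm_connection`). In its curvature all terms in `θ`
cancel (`curvatureUp_fubiniStudyForm`), leaving the curvature tensor of constant holomorphic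
sectional curvature 4, a quadratic expression in `g` and the Kähler form `Ω = Im h`
(`riemannTensor_fubiniStudyForm`).

The rest is linear algebra at one point. The metric is Einstein with `Ric = 6 g` and `s = 24`, so on
a 2-form `β` with raised form `ρ` the Weyl operator is `W β = -g ρ gᵀ + Ω ρ Ωᵀ + ⟨Ω, ρ⟩ Ω`, with
`⟨Ω, ρ⟩` the full contraction. The first term is `-β`, the second is `J β Jᵀ`. For the complex
orientation `Λ²₊` is spanned by `Ω` and the real and imaginary parts of the (2,0)-forms, so `Λ²₋`
consists of the primitive (1,1)-forms (`antiSelfDualPart_relations`). On these `J β Jᵀ = β` and `⟨Ω,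
ρ⟩ = 0`, hence `W β = 0` (`weylOperator_eq_zero`). -/

theorem metricInChart_fubiniStudy (i : Fin (n + 1)) :
    metricInChart (fubiniStudy (n := n)) (affineChart i) = fubiniStudyForm := by
  funext z v w
  set p : CP n := (affineChart i).symm z with hp
  obtain ⟨j, hj⟩ : ∃ j, chartAt (CAff n) p = affineChart j := ⟨_, rfl⟩
  have hpj : p ∈ (affineChart j : OpenPartialHomeomorph (CP n) (CAff n)).source :=
    hj ▸ mem_chart_source (CAff n) p
  have hz : affineLift i z j ≠ 0 := by
    have : z ∈ ((affineChart i).symm.trans (affineChart j)).source := by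
      rw [OpenPartialHomeomorph.trans_source]
      exact ⟨Set.mem_univ _, hpj⟩
    rwa [affineChart_symm_trans_source] at this
  have hd : MDifferentiableAt 𝓘(ℝ, CAff n) 𝓘(ℝ, CAff n) (affineChart i).symm z :=
    (mdifferentiableOn_atlas_symm (I := 𝓘(ℝ, CAff n)) (Set.mem_range_self i)).mdifferentiableAt
      ((affineChart i).open_target.mem_nhds (Set.mem_univ z))
  -- The tangent space at `p` is read in its preferred chart `j`, so the inverse of chart `i`
  -- differentiates to a coordinate change; invariance of the form then removes `j`.
  have hm : ∀ u : CAff n, mfderiv 𝓘(ℝ, CAff n) 𝓘(ℝ, CAff n) (affineChart i).symm z u =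
      fderiv ℝ (coordChange i j) z u := by
    intro u
    rw [hd.mfderiv]
    have : writtenInExtChartAt 𝓘(ℝ, CAff n) 𝓘(ℝ, CAff n) z (affineChart i).symm =
        coordChange i j := by
      funext y
      simp only [writtenInExtChartAt, mfld_simps]
      rw [← hp, hj, chartAt_self_eq]
      exact affineChart_symm_trans i j y
    rw [this]
    simp [fderivWithin_univ, chartAt_self_eq]
    rfl
  have hc : chartAt (CAff n) p p = coordChange i j z := by
    rw [hj, hp, affineChart_symm_trans]
  rw [← fubiniStudyForm_coordChange hz v w, ← hc, ← hm v, ← hm w]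
  rfl

/-! ### The Hermitian form and its first derivatives. -/

/-- The `(1,0)`-form `∂ log (1 + |z|²)`. -/
def fubiniStudyPotential (z v : CAff n) : ℂ := inner ℂ z v / (1 + inner ℂ z z)

/-- The Hermitian form whose real part is the Fubini–Study metric. -/
def fubiniStudyHerm (z v w : CAff n) : ℂ :=
  inner ℂ v w / (1 + inner ℂ z z) -
    (starRingEnd ℂ) (fubiniStudyPotential z v) * fubiniStudyPotential z w

theorem one_add_inner_self (z : CAff n) : 1 + inner ℂ z z = ((1 + ‖z‖ ^ 2 : ℝ) : ℂ) := by
  rw [inner_self_eq_norm_sq_to_K (𝕜 := ℂ)]; push_cast; rfl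

theorem one_add_inner_self_ne_zero (z : CAff n) : 1 + inner ℂ z z ≠ 0 := by
  rw [one_add_inner_self]
  exact_mod_cast (by positivity : (0 : ℝ) < 1 + ‖z‖ ^ 2).ne'

theorem conj_one_add_inner_self (z : CAff n) :
    (starRingEnd ℂ) (1 + inner ℂ z z) = 1 + inner ℂ z z := by
  rw [one_add_inner_self, Complex.conj_ofReal]

theorem fubiniStudyForm_eq_re (z v w : CAff n) :
    fubiniStudyForm z v w = (fubiniStudyHerm z v w).re := by
  have h := one_add_inner_self_ne_zero z
  have h' := one_add_inner_self z
  rw [fubiniStudyForm, one_add_norm_sq, ← h']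
  unfold fubiniStudyHerm fubiniStudyPotential
  rw [map_div₀, conj_one_add_inner_self, inner_conj_symm]
  congr 1
  field_simp

theorem conj_fubiniStudyHerm (z v w : CAff n) :
    (starRingEnd ℂ) (fubiniStudyHerm z v w) = fubiniStudyHerm z w v := by
  simp only [fubiniStudyHerm, map_sub, map_div₀, map_mul, conj_one_add_inner_self,
    inner_conj_symm, Complex.conj_conj]
  ring

theorem fubiniStudyPotential_add (z v w : CAff n) : fubiniStudyPotential z (v + w) =
    fubiniStudyPotential z v + fubiniStudyPotential z w := by
  simp only [fubiniStudyPotential, inner_add_right]; ring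

theorem fubiniStudyPotential_smul (z v : CAff n) (c : ℂ) :
    fubiniStudyPotential z (c • v) = c * fubiniStudyPotential z v := by
  simp only [fubiniStudyPotential, inner_smul_right]; ring

theorem fubiniStudyHerm_add_right (z v w w' : CAff n) : fubiniStudyHerm z v (w + w') =
    fubiniStudyHerm z v w + fubiniStudyHerm z v w' := by
  simp only [fubiniStudyHerm, fubiniStudyPotential_add, inner_add_right]; ring

theorem fubiniStudyHerm_smul_right (z v w : CAff n) (c : ℂ) : fubiniStudyHerm z v (c • w) =
    c * fubiniStudyHerm z v w := by
  simp only [fubiniStudyHerm, fubiniStudyPotential_smul, inner_smul_right]; ring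

/-- The logarithmic derivative of `N` along `u` is `θ(u)` plus its conjugate. The conjugate part
completes `⟨u, v⟩ / N` to `h(u, v)`; the other part leaves the product of potentials. -/
theorem hasFDerivAt_fubiniStudyPotential (z v : CAff n) :
    ∃ A : CAff n →L[ℝ] ℂ, HasFDerivAt (fun y => fubiniStudyPotential y v) A z ∧
      ∀ u, A u = fubiniStudyHerm z u v - fubiniStudyPotential z u * fubiniStudyPotential z v := by
  have hi := hasFDerivAt_id (𝕜 := ℝ) z
  have h0 := one_add_inner_self_ne_zero z
  have hN := (hi.inner ℂ hi).const_add 1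
  have hv := hi.inner ℂ (hasFDerivAt_const (𝕜 := ℝ) v z)
  have hn := (hasDerivAt_inv h0).hasFDerivAt.restrictScalars ℝ
  have h := hv.mul (hn.comp z hN)
  refine ⟨_, h.congr_of_eventuallyEq (.of_forall fun y => ?_), fun u => ?_⟩
  · exact div_eq_mul_inv _ _
  · have e : (starRingEnd ℂ) (inner ℂ z u) = inner ℂ u z := inner_conj_symm _ _
    simp only [fubiniStudyHerm, fubiniStudyPotential, map_div₀, conj_one_add_inner_self, e]
    simp [-inner_self_eq_norm_sq_to_K]
    generalize 1 + inner ℂ z z = N at h0 ⊢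
    field_simp
    ring

theorem hasFDerivAt_fubiniStudyHerm (z v w : CAff n) :
    ∃ A : CAff n →L[ℝ] ℂ, HasFDerivAt (fun y => fubiniStudyHerm y v w) A z ∧
      ∀ u, A u =
        -(fubiniStudyPotential z u + (starRingEnd ℂ) (fubiniStudyPotential z u)) *
            fubiniStudyHerm z v w
          - fubiniStudyHerm z v u * fubiniStudyPotential z w
          - (starRingEnd ℂ) (fubiniStudyPotential z v) * fubiniStudyHerm z u w := by
  have hi := hasFDerivAt_id (𝕜 := ℝ) z
  have h0 := one_add_inner_self_ne_zero z
  have hN := (hi.inner ℂ hi).const_add 1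
  have hn := (hasDerivAt_inv h0).hasFDerivAt.restrictScalars ℝ
  obtain ⟨A, hA, hA'⟩ := hasFDerivAt_fubiniStudyPotential z v
  obtain ⟨B, hB, hB'⟩ := hasFDerivAt_fubiniStudyPotential z w
  have hc := (Complex.conjCLE.toContinuousLinearMap.hasFDerivAt (x := fubiniStudyPotential z v)).comp z hA
  have h := ((hn.comp z hN).const_mul (inner ℂ v w)).sub (hc.mul hB)
  refine ⟨_, h.congr_of_eventuallyEq (.of_forall fun y => ?_), fun u => ?_⟩
  · simp [fubiniStudyHerm, div_eq_mul_inv]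
  · have e : (starRingEnd ℂ) (inner ℂ z u) = inner ℂ u z := inner_conj_symm _ _
    -- Inner products are traded for `θ`, `h` and `N`, so that the claim becomes a rational identity
    -- in these quantities.
    have e1 : inner ℂ z u = fubiniStudyPotential z u * (1 + inner ℂ z z) := by
      rw [fubiniStudyPotential, div_mul_cancel₀ _ h0]
    have e2 : inner ℂ u z = (starRingEnd ℂ) (fubiniStudyPotential z u) * (1 + inner ℂ z z) := by
      rw [← e, e1, map_mul, conj_one_add_inner_self]
    have e3 : inner ℂ v w = (fubiniStudyHerm z v w +
        (starRingEnd ℂ) (fubiniStudyPotential z v) * fubiniStudyPotential z w) *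
          (1 + inner ℂ z z) := by
      rw [fubiniStudyHerm]; field_simp; ring
    have e4 := conj_fubiniStudyHerm z u v
    simp [hA', hB', e4, -inner_self_eq_norm_sq_to_K]
    rw [e1, e2, e3]
    generalize 1 + inner ℂ z z = N at h0 ⊢
    field_simp
    ring

/-! ### The Levi-Civita connection. -/

/-- The vector `∇_v w` at `z`, for constant vector fields `v` and `w`. -/
def fubiniStudyConnection (z v w : CAff n) : CAff n :=
  -(fubiniStudyPotential z v • w + fubiniStudyPotential z w • v)

theorem hasFDerivAt_fubiniStudyConnection (z v w : CAff n) :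
    ∃ A : CAff n →L[ℝ] CAff n, HasFDerivAt (fun y => fubiniStudyConnection y v w) A z ∧
      ∀ u, A u =
        -((fubiniStudyHerm z u v - fubiniStudyPotential z u * fubiniStudyPotential z v) • w +
          (fubiniStudyHerm z u w - fubiniStudyPotential z u * fubiniStudyPotential z w) • v) := by
  obtain ⟨A, hA, hA'⟩ := hasFDerivAt_fubiniStudyPotential z v
  obtain ⟨B, hB, hB'⟩ := hasFDerivAt_fubiniStudyPotential z w
  exact ⟨_, ((hA.smul_const w).add (hB.smul_const v)).neg, fun u => by simp [hA', hB']⟩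

/-- The connection satisfies the Koszul formula. -/
theorem fubiniStudyForm_connection (z u v w : CAff n) :
    fubiniStudyForm z u (fubiniStudyConnection z v w) =
      (1 / 2) * (fderiv ℝ (fun y => fubiniStudyForm y w u) z v
        + fderiv ℝ (fun y => fubiniStudyForm y v u) z w
        - fderiv ℝ (fun y => fubiniStudyForm y v w) z u) := by
  have h (a b c : CAff n) : fderiv ℝ (fun y => fubiniStudyForm y a b) z c =
      (-(fubiniStudyPotential z c + (starRingEnd ℂ) (fubiniStudyPotential z c)) *
            fubiniStudyHerm z a b
          - fubiniStudyHerm z a c * fubiniStudyPotential z b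
          - (starRingEnd ℂ) (fubiniStudyPotential z a) * fubiniStudyHerm z c b).re := by
    obtain ⟨A, hA, hA'⟩ := hasFDerivAt_fubiniStudyHerm z a b
    have := (Complex.reCLM.hasFDerivAt (x := fubiniStudyHerm z a b)).comp z hA
    simp only [fubiniStudyForm_eq_re]
    rw [← hA' c]
    exact congrArg (fun L : CAff n →L[ℝ] ℝ => L c) this.fderiv
  have hg : fubiniStudyHerm z u (fubiniStudyConnection z v w) =
      -(fubiniStudyPotential z v * fubiniStudyHerm z u w +
        fubiniStudyPotential z w * fubiniStudyHerm z u v) := by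
    rw [fubiniStudyConnection, ← neg_one_smul ℂ, fubiniStudyHerm_smul_right,
      fubiniStudyHerm_add_right, fubiniStudyHerm_smul_right, fubiniStudyHerm_smul_right]
    ring
  rw [h, h, h, fubiniStudyForm_eq_re, hg]
  -- Hermitian symmetry writes both orders of each pair through one value of `h`, so that real and
  -- imaginary parts can be matched.
  rw [← conj_fubiniStudyHerm z u w, ← conj_fubiniStudyHerm z u v, ← conj_fubiniStudyHerm z v w]
  simp
  ring

/-! ### Christoffel symbols and curvature in a real basis. -/

variable {ι : Type*} [Fintype ι] (b : Module.Basis ι ℝ (CAff n))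

theorem sum_metricMatrix_fubiniStudyForm_mul (z v : CAff n) (k : ι) :
    ∑ m, metricMatrix b fubiniStudyForm z k m * b.repr v m = fubiniStudyForm z (b k) v := by
  conv_rhs => rw [← b.sum_repr v]
  change _ = fubiniStudyBilin z (b k) _
  rw [map_sum]
  refine Finset.sum_congr rfl fun m _ => ?_
  rw [map_smul, smul_eq_mul, mul_comm]
  rfl

variable [DecidableEq ι]

/-- A kernel vector would be orthogonal to everything, in particular to itself, against positive
definiteness. This makes the matrix inverse in the Christoffel symbols a genuine inverse. -/
theorem isUnit_det_metricMatrix_fubiniStudyForm (z : CAff n) :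
    IsUnit (metricMatrix b fubiniStudyForm z).det := by
  rw [isUnit_iff_ne_zero]
  intro h
  obtain ⟨c, hc, hc'⟩ := Matrix.exists_mulVec_eq_zero_iff.2 h
  set v : CAff n := b.equivFun.symm c
  have hr : ∀ m, b.repr v m = c m := fun m => by
    rw [← b.equivFun_apply, LinearEquiv.apply_symm_apply]
  have h0 (k : ι) : fubiniStudyForm z (b k) v = 0 := by
    rw [← sum_metricMatrix_fubiniStudyForm_mul]
    simp only [hr]
    exact congrFun hc' k
  have h1 : fubiniStudyBilin z v = 0 := by
    refine b.ext fun k => ?_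
    change fubiniStudyForm z v (b k) = 0
    rw [fubiniStudyForm_symm, h0]
  have h2 : fubiniStudyForm z v v = 0 := congrArg (fun A => A v) h1
  have h3 := le_fubiniStudyForm z v
  rw [h2] at h3
  have hv : v = 0 := by
    by_contra hv
    have : 0 < ‖v‖ := norm_pos_iff.2 hv
    exact absurd h3 (not_le.2 (by positivity))
  exact hc (funext fun m => by rw [← hr m, hv]; simp)

/-- The Koszul formula identifies the lowered symbols with those of the explicit connection, and the
metric is invertible. -/
theorem christoffel_fubiniStudyForm (z : CAff n) (k i j : ι) :
    christoffel b fubiniStudyForm k i j z = b.repr (fubiniStudyConnection z (b i) (b j)) k := by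
  set M := metricMatrix b fubiniStudyForm z with hM
  have h1 : M⁻¹.mulVec (M.mulVec (b.repr (fubiniStudyConnection z (b i) (b j)))) =
      b.repr (fubiniStudyConnection z (b i) (b j)) := by
    rw [Matrix.mulVec_mulVec,
      Matrix.nonsing_inv_mul _ (isUnit_det_metricMatrix_fubiniStudyForm b z), Matrix.one_mulVec]
  rw [← h1, christoffel, Finset.mul_sum]
  refine Finset.sum_congr rfl fun l _ => ?_
  have h2 : M.mulVec (b.repr (fubiniStudyConnection z (b i) (b j))) l =
      fubiniStudyForm z (b l) (fubiniStudyConnection z (b i) (b j)) :=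
    sum_metricMatrix_fubiniStudyForm_mul b z _ l
  rw [h2, fubiniStudyForm_connection]
  exact mul_left_comm _ _ _

/-- The products of potentials coming from the derivatives of the connection cancel those coming
from its composition with itself; only `h` survives. -/
theorem curvatureUp_fubiniStudyForm (z : CAff n) (l k i j : ι) :
    curvatureUp b fubiniStudyForm l k i j z =
      b.repr (fubiniStudyHerm z (b j) (b k) • b i - fubiniStudyHerm z (b i) (b k) • b j -
        (fubiniStudyHerm z (b i) (b j) - fubiniStudyHerm z (b j) (b i)) • b k) l := by
  have hd (i j : ι) : fderiv ℝ (christoffel b fubiniStudyForm l j k) z (b i) =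
      b.repr (-((fubiniStudyHerm z (b i) (b j) - fubiniStudyPotential z (b i) *
          fubiniStudyPotential z (b j)) • b k +
        (fubiniStudyHerm z (b i) (b k) - fubiniStudyPotential z (b i) *
          fubiniStudyPotential z (b k)) • b j)) l := by
    obtain ⟨A, hA, hA'⟩ := hasFDerivAt_fubiniStudyConnection z (b j) (b k)
    have h := ((b.coord l).toContinuousLinearMap.hasFDerivAt
      (x := fubiniStudyConnection z (b j) (b k))).comp z hA
    have e : christoffel b fubiniStudyForm l j k =
        (b.coord l).toContinuousLinearMap ∘ fun y => fubiniStudyConnection y (b j) (b k) :=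
      funext fun y => christoffel_fubiniStudyForm b y l j k
    rw [e, h.fderiv, ← hA']
    rfl
  have hs (i j : ι) : ∑ m, christoffel b fubiniStudyForm l i m z *
      christoffel b fubiniStudyForm m j k z =
      b.repr (fubiniStudyConnection z (b i) (fubiniStudyConnection z (b j) (b k))) l := by
    simp only [christoffel_fubiniStudyForm]
    set w := fubiniStudyConnection z (b j) (b k)
    -- Real linearity in the second argument turns the sum over the real basis into a composition of
    -- connection maps.
    let T : CAff n →ₗ[ℝ] CAff n :=
      { toFun := fubiniStudyConnection z (b i)
        map_add' := fun x y => by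
          simp only [fubiniStudyConnection, fubiniStudyPotential_add]; module
        map_smul' := fun c x => by
          have h (y : CAff n) : (c • y : CAff n) = (c : ℂ) • y := by ext; simp
          simp only [fubiniStudyConnection, RingHom.id_apply, h, fubiniStudyPotential_smul]
          module }
    change ∑ m, b.repr (T (b m)) l * b.repr w m = b.repr (T w) l
    conv_rhs => rw [← b.sum_repr w]
    rw [map_sum, map_sum, Finset.sum_apply']
    refine Finset.sum_congr rfl fun m _ => ?_
    rw [map_smul, map_smul, Finsupp.smul_apply, smul_eq_mul, mul_comm]
  rw [curvatureUp, Finset.sum_sub_distrib, hd, hd, hs, hs, ← Finsupp.sub_apply, ← Finsupp.sub_apply,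
    ← Finsupp.add_apply, ← map_sub, ← map_sub, ← map_add]
  congr 2
  simp only [fubiniStudyConnection, ← neg_one_smul ℂ (_ + _), fubiniStudyPotential_add,
    fubiniStudyPotential_smul]
  module

/-- The Fubini–Study metric has constant holomorphic sectional curvature `4`. -/
theorem riemannTensor_fubiniStudyForm (z : CAff n) (i j k l : ι) :
    riemannTensor b fubiniStudyForm i j k l z =
      (fubiniStudyHerm z (b i) (b k)).re * (fubiniStudyHerm z (b j) (b l)).re
      - (fubiniStudyHerm z (b i) (b l)).re * (fubiniStudyHerm z (b j) (b k)).re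
      + ((fubiniStudyHerm z (b i) (b k)).im * (fubiniStudyHerm z (b j) (b l)).im
      - (fubiniStudyHerm z (b i) (b l)).im * (fubiniStudyHerm z (b j) (b k)).im)
      + 2 * (fubiniStudyHerm z (b i) (b j)).im * (fubiniStudyHerm z (b k) (b l)).im := by
  have hsub (x y : CAff n) : fubiniStudyHerm z (b k) (x - y) =
      fubiniStudyHerm z (b k) x - fubiniStudyHerm z (b k) y := by
    rw [sub_eq_add_neg, ← neg_one_smul ℂ, fubiniStudyHerm_add_right, fubiniStudyHerm_smul_right]
    ring
  rw [riemannTensor]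
  simp only [curvatureUp_fubiniStudyForm]
  rw [sum_metricMatrix_fubiniStudyForm_mul, fubiniStudyForm_eq_re]
  simp only [hsub, fubiniStudyHerm_smul_right]
  rw [← conj_fubiniStudyHerm z (b i) (b k), ← conj_fubiniStudyHerm z (b j) (b k),
    ← conj_fubiniStudyHerm z (b i) (b j)]
  simp
  ring

end CP

/-! ### The Levi-Civita symbol and Hermitian matrices in real form. -/

/-- The Levi-Civita symbol is a Vandermonde determinant. -/
theorem leviCivita_eq (i j k l : Fin 4) :
    leviCivita i j k l =
      ((j : ℝ) - i) * (k - i) * (l - i) * (k - j) * (l - j) * (l - k) / 12 := by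
  -- The 0-1 matrix selects rows `i, j, k, l` of the Vandermonde matrix with nodes 0, 1, 2, 3, whose
  -- determinant is 12.
  have h : (Matrix.of fun r c : Fin 4 => if ![i, j, k, l] r = c then (1 : ℝ) else 0) *
      Matrix.vandermonde (fun m : Fin 4 => (m : ℝ)) =
      Matrix.vandermonde (fun r => ((![i, j, k, l] r : Fin 4) : ℝ)) := by
    ext r c
    simp [Matrix.mul_apply, Matrix.vandermonde_apply]
  have h' := congrArg Matrix.det h
  rw [Matrix.det_mul, Matrix.det_vandermonde, Matrix.det_vandermonde] at h'
  simp [Fin.prod_univ_succ, Fin.prod_Ioi_succ] at h'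
  norm_num at h'
  rw [leviCivita]
  linarith

/-- The real part, in the basis `e₁, i e₁, e₂, i e₂`, of the Hermitian form with matrix
`!![a, r + i s; r - i s, d]`. -/
def hermRe (a r s d : ℝ) : Matrix (Fin 4) (Fin 4) ℝ :=
  !![a, 0, r, -s; 0, a, s, r; r, s, d, 0; -s, r, 0, d]

/-- The imaginary part, in the basis `e₁, i e₁, e₂, i e₂`, of the Hermitian form with matrix
`!![a, r + i s; r - i s, d]`. -/
def hermIm (a r s d : ℝ) : Matrix (Fin 4) (Fin 4) ℝ :=
  !![0, a, s, r; -a, 0, -r, s; -s, r, 0, d; -r, -s, -d, 0]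

/-- The real determinant is the square of the complex 2×2 determinant; this removes the square root
from the Hodge star. -/
theorem det_hermRe (a r s d : ℝ) : (hermRe a r s d).det = (a * d - r ^ 2 - s ^ 2) ^ 2 := by
  simp [hermRe, Matrix.det_succ_row_zero, Fin.sum_univ_succ, Fin.succAbove]
  ring

/-- This is the adjugate formula for the complex 2×2 matrix, carried to its real form. -/
theorem inv_hermRe {a r s d : ℝ} (h : a * d - r ^ 2 - s ^ 2 ≠ 0) :
    (hermRe a r s d)⁻¹ = (a * d - r ^ 2 - s ^ 2)⁻¹ • hermRe d (-r) (-s) a := by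
  refine Matrix.inv_eq_right_inv ?_
  rw [Matrix.mul_smul, inv_smul_eq_iff₀ h]
  ext i j
  fin_cases i <;> fin_cases j <;> simp [hermRe, Matrix.mul_apply, Fin.sum_univ_four] <;> ring

/-! ### Ricci, scalar and Weyl curvature of the complex space form. -/

section

variable {E : Type*} [NormedAddCommGroup E] [NormedSpace ℝ E] {b : Module.Basis (Fin 4) ℝ E}
  {G : E → E → E → ℝ} {x : E} {a r s d : ℝ}

/-- The curvature tensor of constant holomorphic sectional curvature `4`, for the Hermitian form
with real part `A` and imaginary part `B`. -/
def complexSpaceForm {ι : Type*} (A B : Matrix ι ι ℝ) (i j k l : ι) : ℝ :=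
  A i k * A j l - A i l * A j k + (B i k * B j l - B i l * B j k) + 2 * B i j * B k l

/-- The constant is 6 = 3 + 1 + 2: the traces of the metric terms, of the antisymmetrized `Ω` terms
and of `2 Ω ⊗ Ω`. -/
theorem ricciTensor_eq (hD : 0 < a * d - r ^ 2 - s ^ 2)
    (hg : metricMatrix b G x = hermRe a r s d)
    (hR : ∀ i j k l, riemannTensor b G i j k l x =
      complexSpaceForm (hermRe a r s d) (hermIm a r s d) i j k l) :
    ricciTensor b G x = (6 : ℝ) • hermRe a r s d := by
  have h := hD.ne'
  ext j l
  rw [ricciTensor, hg, inv_hermRe h]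
  simp only [hR, complexSpaceForm, Matrix.of_apply, Matrix.smul_apply, smul_eq_mul, mul_assoc,
    ← Finset.mul_sum]
  rw [inv_mul_eq_iff_eq_mul₀ h]
  fin_cases j <;> fin_cases l <;> simp [hermRe, hermIm, Fin.sum_univ_four] <;> ring

theorem scalarCurvature_eq (hD : 0 < a * d - r ^ 2 - s ^ 2)
    (hg : metricMatrix b G x = hermRe a r s d)
    (hR : ∀ i j k l, riemannTensor b G i j k l x =
      complexSpaceForm (hermRe a r s d) (hermIm a r s d) i j k l) :
    scalarCurvature b G x = 24 := by
  have h := hD.ne'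
  rw [scalarCurvature, ricciTensor_eq hD hg hR, hg, inv_hermRe h]
  simp only [Matrix.smul_apply, smul_eq_mul, mul_assoc, ← Finset.mul_sum]
  rw [inv_mul_eq_iff_eq_mul₀ h]
  simp [hermRe, Fin.sum_univ_four]
  ring

/-- The Einstein condition kills the trace-free Ricci term, and `s / (2n(n-1)) = 24 / 24 = 1`. -/
theorem weylTensor_eq (hD : 0 < a * d - r ^ 2 - s ^ 2)
    (hg : metricMatrix b G x = hermRe a r s d)
    (hR : ∀ i j k l, riemannTensor b G i j k l x =
      complexSpaceForm (hermRe a r s d) (hermIm a r s d) i j k l) (i j k l : Fin 4) :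
    weylTensor b G i j k l x =
      complexSpaceForm (hermRe a r s d) (hermIm a r s d) i j k l -
        kulkarniNomizu (hermRe a r s d) (hermRe a r s d) i j k l := by
  have h0 : traceFreeRicci b G x = 0 := by
    rw [traceFreeRicci, ricciTensor_eq hD hg hR, scalarCurvature_eq hD hg hR, hg, ← sub_smul]
    norm_num
  rw [weylTensor, h0, hR, scalarCurvature_eq hD hg hR, hg]
  simp [kulkarniNomizu]
  ring

/-! ### The complex structure, the Hodge star and anti-self-dual forms. -/

/-- The complex structure in the basis `e₁, i e₁, e₂, i e₂`. -/
def complexStructureMatrix : Matrix (Fin 4) (Fin 4) ℝ :=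
  !![0, 1, 0, 0; -1, 0, 0, 0; 0, 0, 0, 1; 0, 0, -1, 0]

theorem hermIm_eq_mul_hermRe : hermIm a r s d = complexStructureMatrix * hermRe a r s d := by
  ext i j
  fin_cases i <;> fin_cases j <;>
    simp [hermIm, hermRe, complexStructureMatrix, Matrix.mul_apply, Fin.sum_univ_four]

theorem raiseIndices_eq {ι : Type*} [Fintype ι] [DecidableEq ι] {b : Module.Basis ι ℝ E}
    (α : Matrix ι ι ℝ) : raiseIndices b G x α =
      (metricMatrix b G x)⁻¹ * α * (metricMatrix b G x)⁻¹.transpose := by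
  ext k l
  simp only [raiseIndices, Matrix.of_apply, Matrix.mul_apply, Finset.sum_mul,
    Matrix.transpose_apply]
  rw [Finset.sum_comm]
  exact Finset.sum_congr rfl fun _ _ => Finset.sum_congr rfl fun _ _ => by ring

theorem transpose_raiseIndices {ι : Type*} [Fintype ι] [DecidableEq ι] {b : Module.Basis ι ℝ E}
    {α : Matrix ι ι ℝ} (hα : α.transpose = -α) :
    (raiseIndices b G x α).transpose = -raiseIndices b G x α := by
  simp [raiseIndices_eq, Matrix.transpose_mul, hα, Matrix.mul_assoc]

theorem skew_eq {α : Matrix (Fin 4) (Fin 4) ℝ} (hα : α.transpose = -α) :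
    α = !![0, α 0 1, α 0 2, α 0 3; -α 0 1, 0, α 1 2, α 1 3;
      -α 0 2, -α 1 2, 0, α 2 3; -α 0 3, -α 1 3, -α 2 3, 0] := by
  have h (i j : Fin 4) : α j i = -α i j := congrFun (congrFun hα i) j
  have h0 (i : Fin 4) : α i i = 0 := by linarith [h i i]
  ext i j
  fin_cases i <;> fin_cases j <;> simp [h0] <;> exact h _ _

/-- Each entry sees only the complementary index pair, counted in both orders, which cancels the
factor 1/2; positivity of the complex determinant makes it the root of `det g`. -/
theorem hodgeStar_eq (hD : 0 < a * d - r ^ 2 - s ^ 2)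
    (hg : metricMatrix b G x = hermRe a r s d) {α ρ : Matrix (Fin 4) (Fin 4) ℝ}
    (hρ : ρ.transpose = -ρ) (h : raiseIndices b G x α = ρ) :
    hodgeStar b G x α = (a * d - r ^ 2 - s ^ 2) •
      !![0, ρ 2 3, -ρ 1 3, ρ 1 2; -ρ 2 3, 0, ρ 0 3, -ρ 0 2;
        ρ 1 3, -ρ 0 3, 0, ρ 0 1; -ρ 1 2, ρ 0 2, -ρ 0 1, 0] := by
  have hs (i j : Fin 4) : ρ j i = -ρ i j := congrFun (congrFun hρ i) j
  ext i j
  rw [hodgeStar, hg, det_hermRe, Real.sqrt_sq hD.le, h]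
  simp only [leviCivita_eq, mul_assoc, ← Finset.mul_sum, Matrix.of_apply, Matrix.smul_apply,
    smul_eq_mul]
  rw [mul_left_comm]
  congr 1
  fin_cases i <;> fin_cases j <;> simp [Fin.sum_univ_four] <;>
    linarith [hs 0 1, hs 0 2, hs 0 3, hs 1 2, hs 1 3, hs 2 3]

theorem transpose_antiSelfDualPart (hD : 0 < a * d - r ^ 2 - s ^ 2)
    (hg : metricMatrix b G x = hermRe a r s d) {α : Matrix (Fin 4) (Fin 4) ℝ}
    (hα : α.transpose = -α) :
    (antiSelfDualPart b G x α).transpose = -antiSelfDualPart b G x α := by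
  have h : (hodgeStar b G x α).transpose = -hodgeStar b G x α := by
    rw [hodgeStar_eq hD hg (transpose_raiseIndices hα) rfl]
    ext i j
    fin_cases i <;> fin_cases j <;> simp
  rw [antiSelfDualPart, Matrix.transpose_smul, Matrix.transpose_sub, hα, h]
  module

/-- Anti-self-dual forms are of type `(1,1)` and primitive. -/
theorem antiSelfDualPart_relations (hD : 0 < a * d - r ^ 2 - s ^ 2)
    (hg : metricMatrix b G x = hermRe a r s d) {α : Matrix (Fin 4) (Fin 4) ℝ}
    (hα : α.transpose = -α) {β : Matrix (Fin 4) (Fin 4) ℝ}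
    (hβ : antiSelfDualPart b G x α = β) :
    β 0 2 = β 1 3 ∧ β 0 3 = -β 1 2 ∧
      d * β 0 1 + a * β 2 3 = 2 * r * β 0 3 + 2 * s * β 0 2 := by
  have h := hD.ne'
  have hr := raiseIndices_eq (b := b) (G := G) (x := x) α
  rw [hg, inv_hermRe h, skew_eq hα] at hr
  subst hβ
  rw [antiSelfDualPart, hodgeStar_eq hD hg (transpose_raiseIndices hα) rfl, skew_eq hα]
  rw [hr]
  generalize α 0 1 = y1, α 0 2 = y2, α 0 3 = y3, α 1 2 = y4, α 1 3 = y5, α 2 3 = y6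
  -- The determinant stays opaque while denominators are cleared and is expanded only for the final
  -- polynomial identities.
  generalize hE : a * d - r ^ 2 - s ^ 2 = D at h ⊢
  simp [hermRe, Matrix.mul_apply, Fin.sum_univ_four]
  refine ⟨?_, ?_, ?_⟩ <;> field_simp <;> rw [← hE] <;> ring

/-! ### The Weyl operator on primitive (1,1)-forms. -/

theorem sum_minors_mul_skew {ι : Type*} [Fintype ι] (A : Matrix ι ι ℝ) {ρ : Matrix ι ι ℝ}
    (hρ : ρ.transpose = -ρ) (i j : ι) :
    ∑ k, ∑ l, (A i k * A j l - A i l * A j k) * ρ k l = 2 * (A * ρ * A.transpose) i j := by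
  have h : ∑ k, ∑ l, A i l * A j k * ρ k l = -∑ k, ∑ l, A i k * A j l * ρ k l := by
    rw [Finset.sum_comm]
    simp only [← Finset.sum_neg_distrib]
    refine Finset.sum_congr rfl fun k _ => Finset.sum_congr rfl fun l _ => ?_
    have : ρ l k = -ρ k l := congrFun (congrFun hρ k) l
    rw [this]; ring
  simp only [sub_mul, Finset.sum_sub_distrib]
  rw [h, sub_neg_eq_add, ← two_mul, Finset.sum_comm]
  congr 1
  simp only [Matrix.mul_apply, Finset.sum_mul, Matrix.transpose_apply]
  exact Finset.sum_congr rfl fun _ _ => Finset.sum_congr rfl fun _ _ => by ring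

/-- This contraction with the Kähler form is what primitivity means; `h3` is its coordinate
expression once the form has type (1,1). -/
theorem sum_hermIm_mul_raiseIndices (hD : 0 < a * d - r ^ 2 - s ^ 2)
    (hg : metricMatrix b G x = hermRe a r s d) {β : Matrix (Fin 4) (Fin 4) ℝ}
    (hβ : β.transpose = -β) (h1 : β 0 2 = β 1 3) (h2 : β 0 3 = -β 1 2)
    (h3 : d * β 0 1 + a * β 2 3 = 2 * r * β 0 3 + 2 * s * β 0 2) :
    ∑ k, ∑ l, hermIm a r s d k l * raiseIndices b G x β k l = 0 := by
  rw [raiseIndices_eq, hg, inv_hermRe hD.ne', skew_eq hβ]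
  simp only [Matrix.smul_mul, Matrix.mul_smul, Matrix.transpose_smul, Matrix.smul_apply,
    smul_eq_mul, mul_left_comm _ (a * d - r ^ 2 - s ^ 2)⁻¹, ← Finset.mul_sum]
  refine mul_eq_zero_of_right _ (mul_eq_zero_of_right _ ?_)
  simp [hermRe, hermIm, Matrix.mul_apply, Fin.sum_univ_four]
  rw [← h1, ← neg_eq_iff_eq_neg.2 h2]
  -- Raising indices brings in two adjugates; one meets the metric inside `Ω = J g` and yields the
  -- determinant. The 2 counts both orders of an index pair.
  linear_combination (2 * (a * d - r ^ 2 - s ^ 2)) * h3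

theorem metricMatrix_mul_raiseIndices_mul {ι : Type*} [Fintype ι] [DecidableEq ι]
    {b : Module.Basis ι ℝ E} (hu : IsUnit (metricMatrix b G x).det) (β : Matrix ι ι ℝ) :
    metricMatrix b G x * raiseIndices b G x β * (metricMatrix b G x).transpose = β := by
  have hu' : (metricMatrix b G x).transpose⁻¹ * (metricMatrix b G x).transpose = 1 :=
    Matrix.nonsing_inv_mul _ (by rwa [Matrix.det_transpose])
  rw [raiseIndices_eq, Matrix.mul_assoc _⁻¹, Matrix.mul_nonsing_inv_cancel_left _ _ hu,
    Matrix.mul_assoc β, Matrix.transpose_nonsing_inv, hu', mul_one]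

/-- The two relations are the coordinate form of type (1,1), that is, of invariance under `J`. -/
theorem complexStructureMatrix_mul_mul {β : Matrix (Fin 4) (Fin 4) ℝ} (hβ : β.transpose = -β)
    (h1 : β 0 2 = β 1 3) (h2 : β 0 3 = -β 1 2) :
    complexStructureMatrix * β * complexStructureMatrix.transpose = β := by
  rw [skew_eq hβ, ← h1, h2]
  ext i j
  fin_cases i <;> fin_cases j <;>
    simp [complexStructureMatrix, Matrix.mul_apply, Fin.sum_univ_four]

theorem weylOperator_eq_zero (hD : 0 < a * d - r ^ 2 - s ^ 2)
    (hg : metricMatrix b G x = hermRe a r s d)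
    (hR : ∀ i j k l, riemannTensor b G i j k l x =
      complexSpaceForm (hermRe a r s d) (hermIm a r s d) i j k l)
    {β : Matrix (Fin 4) (Fin 4) ℝ} (hβ : β.transpose = -β)
    (h1 : β 0 2 = β 1 3) (h2 : β 0 3 = -β 1 2)
    (h3 : d * β 0 1 + a * β 2 3 = 2 * r * β 0 3 + 2 * s * β 0 2) :
    weylOperator b G x β = 0 := by
  have ht := sum_hermIm_mul_raiseIndices hD hg hβ h1 h2 h3
  have hgρ := metricMatrix_mul_raiseIndices_mul (b := b) (G := G) (x := x)
    (by rw [hg, det_hermRe, isUnit_iff_ne_zero]; positivity) β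
  have hΩρ : hermIm a r s d * raiseIndices b G x β * (hermIm a r s d).transpose = β := by
    rw [hermIm_eq_mul_hermRe, Matrix.transpose_mul, ← hg]
    have e (J g ρ : Matrix (Fin 4) (Fin 4) ℝ) :
        J * g * ρ * (g.transpose * J.transpose) = J * (g * ρ * g.transpose) * J.transpose := by
      simp only [Matrix.mul_assoc]
    rw [e, hgρ, complexStructureMatrix_mul_mul hβ h1 h2]
  have hρ := transpose_raiseIndices (b := b) (G := G) (x := x) hβ
  have hW := weylTensor_eq hD hg hR
  rw [hg] at hgρ
  ext i j
  rw [weylOperator, Matrix.of_apply, Matrix.zero_apply]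
  simp only [hW]
  generalize raiseIndices b G x β = ρ at *
  generalize hermRe a r s d = g at *
  generalize hermIm a r s d = Ω at *
  -- The Kulkarni–Nomizu square of `g` is twice its minors, so subtracting it reverses the sign of
  -- the metric term. The three sums become `-2β`, `2β` and 0.
  have e : ∑ k, ∑ l, (complexSpaceForm g Ω i j k l - kulkarniNomizu g g i j k l) * ρ k l =
      -∑ k, ∑ l, (g i k * g j l - g i l * g j k) * ρ k l
      + ∑ k, ∑ l, (Ω i k * Ω j l - Ω i l * Ω j k) * ρ k l
      + 2 * Ω i j * ∑ k, ∑ l, Ω k l * ρ k l := by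
    simp only [Finset.mul_sum, ← Finset.sum_neg_distrib, ← Finset.sum_add_distrib]
    refine Finset.sum_congr rfl fun k _ => Finset.sum_congr rfl fun l _ => ?_
    rw [complexSpaceForm, kulkarniNomizu]
    ring
  rw [e, sum_minors_mul_skew g hρ, sum_minors_mul_skew Ω hρ, ht, hgρ, hΩρ]
  ring

/-- The Weyl operator already vanishes on the inner projection, so the outer projection plays no
role. -/
theorem weylMinus_eq_zero (hD : 0 < a * d - r ^ 2 - s ^ 2)
    (hg : metricMatrix b G x = hermRe a r s d)
    (hR : ∀ i j k l, riemannTensor b G i j k l x =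
      complexSpaceForm (hermRe a r s d) (hermIm a r s d) i j k l)
    {α : Matrix (Fin 4) (Fin 4) ℝ} (hα : α.transpose = -α) : weylMinus b G x α = 0 := by
  obtain ⟨h1, h2, h3⟩ := antiSelfDualPart_relations hD hg hα rfl
  rw [weylMinus, weylOperator_eq_zero hD hg hR (transpose_antiSelfDualPart hD hg hα) h1 h2 h3]
  ext i j
  simp [antiSelfDualPart, hodgeStar, raiseIndices]

end

/-! ### The Hermitian matrix of the Fubini–Study metric. -/

namespace CP

theorem hermRe_fubiniStudyHerm (z : CAff 2) : ∃ a r s d : ℝ, 0 < a * d - r ^ 2 - s ^ 2 ∧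
    (∀ i j, (fubiniStudyHerm z (realBasis i) (realBasis j)).re = hermRe a r s d i j) ∧
    ∀ i j, (fubiniStudyHerm z (realBasis i) (realBasis j)).im = hermIm a r s d i j := by
  set u : CAff 2 := EuclideanSpace.single 0 1 with hu
  set v : CAff 2 := EuclideanSpace.single 1 1 with hv
  have hl (c : ℂ) (x y : CAff 2) :
      fubiniStudyHerm z (c • x) y = (starRingEnd ℂ) c * fubiniStudyHerm z x y := by
    rw [← conj_fubiniStudyHerm, fubiniStudyHerm_smul_right, map_mul, conj_fubiniStudyHerm]
  have b0 : realBasis 0 = u := by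
    ext k; fin_cases k <;> simp [realBasis, realCoord, hu] <;> rfl
  have b1 : realBasis 1 = Complex.I • u := by
    ext k; fin_cases k <;> simp [realBasis, realCoord, hu] <;> rfl
  have b2 : realBasis 2 = v := by
    ext k; fin_cases k <;> simp [realBasis, realCoord, hv] <;> rfl
  have b3 : realBasis 3 = Complex.I • v := by
    ext k; fin_cases k <;> simp [realBasis, realCoord, hv] <;> rfl
  have him (x : CAff 2) : (fubiniStudyHerm z x x).im = 0 :=
    Complex.conj_eq_iff_im.1 (conj_fubiniStudyHerm z x x)
  have hvu := conj_fubiniStudyHerm z u v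
  -- The witnesses are the entries of the complex Gram matrix of `h` in the basis `u, v`, with `h(u,
  -- v) = r + i s`.
  refine ⟨(fubiniStudyHerm z u u).re, (fubiniStudyHerm z u v).re, (fubiniStudyHerm z u v).im,
    (fubiniStudyHerm z v v).re, ?_, fun i j => ?_, fun i j => ?_⟩
  · set N : ℝ := 1 + ‖z‖ ^ 2 with hN
    have hpos : 0 < N := by positivity
    have hN' : N = 1 + ((z 0).re ^ 2 + (z 0).im ^ 2 + ((z 1).re ^ 2 + (z 1).im ^ 2)) := by
      simp only [hN, EuclideanSpace.norm_sq_eq, ← Complex.normSq_eq_norm_sq, Complex.normSq_apply,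
        Fin.sum_univ_two]
      ring
    have huu : inner ℂ u u = 1 := by simp [hu]
    have hvv : inner ℂ v v = 1 := by simp [hv]
    have huv : inner ℂ u v = 0 := by simp [hu, hv, PiLp.inner_apply]
    have hzu : inner ℂ z u = (starRingEnd ℂ) (z 0) := by
      simp [hu, EuclideanSpace.inner_single_right]
    have hzv : inner ℂ z v = (starRingEnd ℂ) (z 1) := by
      simp [hv, EuclideanSpace.inner_single_right]
    simp only [fubiniStudyHerm, fubiniStudyPotential, one_add_inner_self, ← hN, huu, hvv, huv, hzu,
      hzv, map_div₀, Complex.conj_conj, Complex.conj_ofReal, Complex.sub_re, Complex.sub_im,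
      Complex.mul_re, Complex.mul_im, Complex.div_ofReal_re, Complex.div_ofReal_im,
      Complex.conj_re, Complex.conj_im, Complex.one_re, Complex.zero_re, Complex.zero_im]
    -- The complex determinant of `h` on `ℂ²` equals `N⁻³`.
    refine lt_of_lt_of_eq (by positivity : 0 < 1 / N ^ 3) ?_
    field_simp
    rw [hN']
    ring
  · fin_cases i <;> fin_cases j <;>
      simp [b0, b1, b2, b3, hl, fubiniStudyHerm_smul_right, him, ← hvu, hermRe]
  · fin_cases i <;> fin_cases j <;>
      simp [b0, b1, b2, b3, hl, fubiniStudyHerm_smul_right, him, ← hvu, hermIm]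

end CP

theorem mainTheorem11 :
    IsSelfDual CP.realBasis (CP.fubiniStudy : Bundle.ContMDiffRiemannianMetric 𝓘(ℝ, CAff 2) ∞
      (CAff 2) (fun p : CP 2 => TangentSpace 𝓘(ℝ, CAff 2) p)) := by
  rintro _ ⟨i, rfl⟩ z - α hα
  rw [CP.metricInChart_fubiniStudy]
  obtain ⟨a, r, s, d, hD, hre, him⟩ := CP.hermRe_fubiniStudyHerm z
  refine weylMinus_eq_zero hD ?_ (fun i j k l => ?_) hα
  · ext i j
    rw [← hre, ← CP.fubiniStudyForm_eq_re]
    rfl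
  · simp only [CP.riemannTensor_fubiniStudyForm, hre, him, complexSpaceForm]

end
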